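/- Let $q$ be a nonzero complex number with $|q|<1$, and write $(x;q)_n=\prod_{i=0}^{n-1}(1-q^ix)$. Consider the Eulerian forms of the four tenth order mock theta functions, $$\phi(q)=\sum_{n\ge 0}\frac{q^{\binom{n+1}{2}}}{(q;q^2)_{n+1}},\quad \psi(q)=\sum_{n\ge 0}\frac{q^{\binom{n+2}{2}}}{(q;q^2)_{n+1}},\quad X(q)=\sum_{n\ge 0}\frac{(-1)^nq^{n^2}}{(-q;q)_{2n}},\quad \chi(q)=\sum_{n\ge 0}\frac{(-1)^nq^{(n+1)^2}}{(-q;q)_{2n+1}}.$$ Replacing $q$ by $q^{-1}$ in each term of these four series gives, respectively, the terms of the four series on the left-hand sides below. All the series below converge absolutely, and $$\sum_{n=0}^{\infty}\frac{(-1)^{n+1}q^{\binom{n+2}{2}}}{(q;q^2)_{n+1}}=-q\sum_{n=0}^{\infty}(-1)^nq^{-n}q^{5n(n+1)}-q^{2}\sum_{n=0}^{\infty}(-1)^nq^{n}q^{5n(n+1)},$$ $$\sum_{n=0}^{\infty}\frac{(-1)^{n+1}q^{\binom{n+1}{2}}}{(q;q^2)_{n+1}}=-\sum_{n=0}^{\infty}(-1)^nq^{-3n}q^{5n(n+1)}-q^{3}\sum_{n=0}^{\infty}(-1)^nq^{3n}q^{5n(n+1)},$$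 $$\sum_{n=0}^{\infty}\frac{(-1)^nq^{n(n+1)}}{(-q;q)_{2n}}=\sum_{n=0}^{\infty}q^{-2n}q^{5n(n+1)/2}-q^2\sum_{n=0}^{\infty}q^{2n}q^{5n(n+1)/2},$$ $$\sum_{n=0}^{\infty}\frac{(-1)^{n}q^{n(n+1)}}{(-q;q)_{2n+1}}=\sum_{n=0}^{\infty}q^{-n}q^{5n(n+1)/2}-q\sum_{n=0}^{\infty}q^{n}q^{5n(n+1)/2}.$$ -/

import Mathlib

/-- The finite `q`-Pochhammer symbol `(x; q)_n = ∏_{i=0}^{n-1} (1 - q^i x)`. -/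
noncomputable def qPoch (x q : ℂ) (n : ℕ) : ℂ := ∏ i ∈ Finset.range n, (1 - q ^ i * x)

/-- The `n`-th term of the Eulerian form `φ(q) = ∑ q^{C(n+1,2)} / (q; q²)_{n+1}`. -/
noncomputable def tenthPhiTerm (q : ℂ) (n : ℕ) : ℂ :=
  q ^ (n + 1).choose 2 / qPoch q (q ^ 2) (n + 1)

/-- The `n`-th term of the Eulerian form `ψ(q) = ∑ q^{C(n+2,2)} / (q; q²)_{n+1}`. -/
noncomputable def tenthPsiTerm (q : ℂ) (n : ℕ) : ℂ :=
  q ^ (n + 2).choose 2 / qPoch q (q ^ 2) (n + 1)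

/-- The `n`-th term of the Eulerian form `X(q) = ∑ (-1)^n q^{n²} / (-q; q)_{2n}`. -/
noncomputable def tenthXTerm (q : ℂ) (n : ℕ) : ℂ :=
  (-1) ^ n * q ^ (n ^ 2) / qPoch (-q) q (2 * n)

/-- The `n`-th term of the Eulerian form `χ(q) = ∑ (-1)^n q^{(n+1)²} / (-q; q)_{2n+1}`. -/
noncomputable def tenthChiTerm (q : ℂ) (n : ℕ) : ℂ :=
  (-1) ^ n * q ^ ((n + 1) ^ 2) / qPoch (-q) q (2 * n + 1)

/-!
The four identities are instances of one limiting case of Bailey's lemma. With base `b` and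
`D_n(r) = 1 / ((b; b)_{n-r} (b; b)_{n+r+1})`, read as zero when an index is negative, the sum
`∑_n (b; b)_n (-1)^n b^{n(n+1)/2} D_n(r)` equals `(-1)^r b^{r(r+1)/2}` for `r ≥ 0`
(`conjugateWeight_natCast`, by telescoping) and is invariant under `r ↦ -1 - r`. Hence, if
`β_n = ∑_{m ∈ ℤ} a_m D_n(r_m)`, interchanging summations turns `∑_n (b; b)_n (-1)^n b^{n(n+1)/2} β_n`
into a partial theta series (`bailey_transform`).

It remains to evaluate `β_n` for `a_m = (-1)^m p^{3m² + km}`. For `X` and `χ` one takes `b = q² = p⁴`,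
`r_m = m` and `k = -1, 1`; for `φ` and `ψ` one takes `b = q = p`, `r_m = 2m` and `k = 3, 1`. The
recursion `(1 - b^k) / (b; b)_k = 1 / (b; b)_{k-1}`, valid for all integers `k`, gives contiguity
relations between the sums over `D_n` and over `C_n(r) = 1 / ((b; b)_{n-r} (b; b)_{n+r})`. For `k = 3`
and a kernel symmetric under `m ↦ -1 - m` the terms cancel in pairs (`thetaSum_three_eq_zero`); this
closes the contiguity relations to a first-order recurrence in `n`, whose solution is a quotient of
products (`thetaSum_base_four_zero`, `thetaSum_even_zero`).

The negative indices `m` account for the second theta series on each right-hand side.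
-/

open Filter Topology

/-! ### Reciprocals of `(b; b)_k` with integer index -/

/-- The reciprocal `1 / (b; b)_k`, extended by zero to negative `k`. -/
noncomputable def qFactInv (b : ℂ) (k : ℤ) : ℂ := if 0 ≤ k then (qPoch b b k.toNat)⁻¹ else 0

theorem qPoch_succ (x q : ℂ) (n : ℕ) : qPoch x q (n + 1) = qPoch x q n * (1 - q ^ n * x) :=
  Finset.prod_range_succ _ _

@[simp] theorem qPoch_zero (x q : ℂ) : qPoch x q 0 = 1 := Finset.prod_range_zero _

theorem one_sub_pow_ne_zero {b : ℂ} (hb : ‖b‖ < 1) {n : ℕ} (hn : n ≠ 0) : 1 - b ^ n ≠ 0 := by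
  intro h
  have h1 : ‖b ^ n‖ = 1 := by rw [← sub_eq_zero.mp h, norm_one]
  rw [norm_pow] at h1
  exact (pow_lt_one₀ (norm_nonneg b) hb hn).ne h1

theorem one_add_pow_ne_zero {b : ℂ} (hb : ‖b‖ < 1) {n : ℕ} (hn : n ≠ 0) : 1 + b ^ n ≠ 0 := by
  intro h
  have h1 : ‖b ^ n‖ = 1 := by rw [eq_neg_of_add_eq_zero_right h, norm_neg, norm_one]
  rw [norm_pow] at h1
  exact (pow_lt_one₀ (norm_nonneg b) hb hn).ne h1

theorem qPoch_self_ne_zero {b : ℂ} (hb : ‖b‖ < 1) (n : ℕ) : qPoch b b n ≠ 0 := by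
  refine Finset.prod_ne_zero_iff.mpr fun i _ => ?_
  rw [← pow_succ]
  exact one_sub_pow_ne_zero hb i.succ_ne_zero

@[simp] theorem qFactInv_natCast (b : ℂ) (n : ℕ) : qFactInv b n = (qPoch b b n)⁻¹ := by
  simp [qFactInv]

theorem qFactInv_of_neg (b : ℂ) {k : ℤ} (hk : k < 0) : qFactInv b k = 0 := by
  simp [qFactInv, not_le.mpr hk]

/-- The recursion of `1 / (b; b)_k`; the extension by zero makes it hold for all integers. -/
theorem qFactInv_mul_one_sub {b : ℂ} (hb : ‖b‖ < 1) {k l : ℤ} (h : k = l + 1) :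
    qFactInv b k * (1 - b ^ k) = qFactInv b l := by
  subst h
  rcases lt_trichotomy (l + 1) 0 with hl | hl | hl
  · rw [qFactInv_of_neg b hl, qFactInv_of_neg b (by omega), zero_mul]
  · rw [hl, qFactInv_of_neg b (show l < 0 by omega)]
    simp
  · obtain ⟨n, rfl⟩ := Int.eq_ofNat_of_zero_le (show 0 ≤ l by omega)
    have e : ((n : ℤ) + 1) = ((n + 1 : ℕ) : ℤ) := by push_cast; rfl
    have h0 := one_sub_pow_ne_zero hb n.succ_ne_zero
    rw [e, qFactInv_natCast, qFactInv_natCast, zpow_natCast, qPoch_succ, ← pow_succ]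
    rw [mul_inv, mul_assoc, inv_mul_cancel₀ h0, mul_one]

theorem norm_qPoch_self_inv_le {b : ℂ} (hb : ‖b‖ < 1) (n : ℕ) :
    ‖(qPoch b b n)⁻¹‖ ≤ ((1 - ‖b‖)⁻¹) ^ n := by
  have h1 : 0 < 1 - ‖b‖ := sub_pos.mpr hb
  induction n with
  | zero => simp
  | succ n ih =>
    rw [qPoch_succ, mul_inv, norm_mul, pow_succ]
    refine mul_le_mul ih ?_ (norm_nonneg _) (by positivity)
    rw [norm_inv]
    refine inv_anti₀ h1 ?_
    have h2 : ‖b ^ n * b‖ ≤ ‖b‖ := by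
      rw [norm_mul, norm_pow]
      exact mul_le_of_le_one_left (norm_nonneg _) (pow_le_one₀ (norm_nonneg _) hb.le)
    have h3 := norm_sub_norm_le (1 : ℂ) (b ^ n * b)
    rw [norm_one] at h3
    linarith

theorem norm_qFactInv_le {b : ℂ} (hb : ‖b‖ < 1) (k : ℤ) {N : ℕ} (hk : k ≤ N) :
    ‖qFactInv b k‖ ≤ ((1 - ‖b‖)⁻¹) ^ N := by
  have h1 : 0 < 1 - ‖b‖ := sub_pos.mpr hb
  rcases lt_or_ge k 0 with h | h
  · rw [qFactInv_of_neg b h, norm_zero]; positivity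
  · obtain ⟨n, rfl⟩ := Int.eq_ofNat_of_zero_le h
    rw [qFactInv_natCast]
    refine (norm_qPoch_self_inv_le hb n).trans (pow_le_pow_right₀ ?_ (by exact_mod_cast hk))
    exact (one_le_inv₀ h1).mpr (by linarith [norm_nonneg b])

/-- The product `1 / ((b; b)_{n - r} (b; b)_{n + r + s})`, the kernel of Bailey pairs relative to
`b ^ s` (up to the factor `(b; b)_s`). -/
noncomputable def baileyKernel (b : ℂ) (s : ℤ) (n : ℕ) (r : ℤ) : ℂ :=
  qFactInv b (n - r) * qFactInv b (n + r + s)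

/-- If one of the two indices of the kernel exceeds `2n + s`, the other one is negative, so the
kernel is bounded uniformly in `r`. -/
theorem norm_baileyKernel_le {b : ℂ} (hb : ‖b‖ < 1) (s n : ℕ) (r : ℤ) :
    ‖baileyKernel b s n r‖ ≤ ((1 - ‖b‖)⁻¹) ^ (2 * n + s) * ((1 - ‖b‖)⁻¹) ^ (2 * n + s) := by
  have h1 : 0 < 1 - ‖b‖ := sub_pos.mpr hb
  have h0 : (0 : ℝ) ≤ ((1 - ‖b‖)⁻¹) ^ (2 * n + s) * ((1 - ‖b‖)⁻¹) ^ (2 * n + s) := by positivity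
  unfold baileyKernel
  by_cases ha : (n : ℤ) - r < 0
  · simpa [qFactInv_of_neg b ha] using h0
  by_cases hc : (n : ℤ) + r + s < 0
  · simpa [qFactInv_of_neg b hc] using h0
  rw [norm_mul]
  exact mul_le_mul (norm_qFactInv_le hb _ (by push_cast; omega))
    (norm_qFactInv_le hb _ (by push_cast; omega)) (norm_nonneg _) (by positivity)

theorem baileyKernel_reflect (b : ℂ) (s : ℤ) (n : ℕ) (r : ℤ) :
    baileyKernel b s n (-s - r) = baileyKernel b s n r := by
  unfold baileyKernel
  rw [mul_comm]
  congr 2 <;> ring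

theorem baileyKernel_one_mul_left {b : ℂ} (hb : ‖b‖ < 1) (n : ℕ) (r : ℤ) :
    baileyKernel b 1 n r * (1 - b ^ (n - r : ℤ)) = baileyKernel b 0 n (r + 1) := by
  unfold baileyKernel
  rw [mul_right_comm, qFactInv_mul_one_sub hb (l := n - (r + 1)) (by ring)]
  congr 2; ring

theorem baileyKernel_one_mul_right {b : ℂ} (hb : ‖b‖ < 1) (n : ℕ) (r : ℤ) :
    baileyKernel b 1 n r * (1 - b ^ (n + r + 1 : ℤ)) = baileyKernel b 0 n r := by
  unfold baileyKernel
  rw [mul_assoc, qFactInv_mul_one_sub hb (l := n + r) (by ring), add_zero]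

theorem baileyKernel_zero_succ_mul_left {b : ℂ} (hb : ‖b‖ < 1) (n : ℕ) (r : ℤ) :
    baileyKernel b 0 (n + 1) r * (1 - b ^ (n + 1 - r : ℤ)) = baileyKernel b 1 n r := by
  unfold baileyKernel
  push_cast
  rw [mul_right_comm, qFactInv_mul_one_sub hb (l := n - r) (by ring)]
  congr 2; ring

/-! ### Summability -/

theorem summable_pow_mul_pow_choose (K : ℝ) {ρ : ℝ} (h0 : 0 ≤ ρ) (h1 : ρ < 1) :
    Summable (fun n : ℕ => K ^ n * ρ ^ n.choose 2) := by
  have ht : Tendsto (fun n : ℕ => |K| * ρ ^ n) atTop (𝓝 0) := by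
    simpa using (tendsto_pow_atTop_nhds_zero_of_lt_one h0 h1).const_mul |K|
  have hev : ∀ᶠ n : ℕ in atTop, |K| * ρ ^ n ≤ 1 / 2 :=
    (ht.eventually (gt_mem_nhds (by norm_num : (0 : ℝ) < 1 / 2))).mono fun _ h => le_of_lt h
  refine summable_of_ratio_norm_eventually_le (r := 1 / 2) (by norm_num) (hev.mono fun n hn => ?_)
  have e : (n + 1).choose 2 = n + n.choose 2 := by
    rw [Nat.choose_succ_succ' n 1, Nat.choose_one_right]
  have : K ^ (n + 1) * ρ ^ (n + 1).choose 2 = (K * ρ ^ n) * (K ^ n * ρ ^ n.choose 2) := by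
    rw [e]; ring
  rw [this, norm_mul]
  refine mul_le_mul_of_nonneg_right ?_ (norm_nonneg _)
  rwa [Real.norm_eq_abs, abs_mul, abs_of_nonneg (pow_nonneg h0 n)]

theorem summable_pow_mul_pow_sq (K : ℝ) {ρ : ℝ} (h0 : 0 ≤ ρ) (h1 : ρ < 1) :
    Summable (fun n : ℕ => K ^ n * ρ ^ n ^ 2) := by
  refine (summable_pow_mul_pow_choose (K * ρ) (ρ := ρ ^ 2) (by positivity)
    (pow_lt_one₀ h0 h1 two_ne_zero)).congr fun n => ?_
  have e : n ^ 2 = n + 2 * n.choose 2 := by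
    rw [Nat.choose_two_right, Nat.mul_div_cancel' (Nat.even_mul_pred_self n).two_dvd]
    cases n with
    | zero => rfl
    | succ n => simp; ring
  rw [e, pow_add, pow_mul]; ring

/-- Theta-like series `∑ p ^ (a n² + k n)` with `a > 0` converge absolutely, whatever `k`. -/
theorem summable_norm_zpow_quadratic {p : ℂ} (hp0 : p ≠ 0) (hp : ‖p‖ < 1) {a : ℕ} (ha : a ≠ 0)
    (k : ℤ) : Summable (fun n : ℕ => ‖p ^ (a * (n : ℤ) ^ 2 + k * n : ℤ)‖) := by
  refine (summable_pow_mul_pow_sq (‖p‖ ^ k) (ρ := ‖p‖ ^ a) (by positivity)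
    (pow_lt_one₀ (norm_nonneg _) hp ha)).congr fun n => ?_
  rw [norm_zpow, zpow_add₀ (norm_ne_zero_iff.mpr hp0), mul_comm, zpow_mul, zpow_mul, zpow_natCast,
    zpow_natCast]
  congr 1

theorem summable_norm_zpow_quadratic_int {p : ℂ} (hp0 : p ≠ 0) (hp : ‖p‖ < 1) {a : ℕ} (ha : a ≠ 0)
    (k : ℤ) : Summable (fun m : ℤ => ‖p ^ (a * m ^ 2 + k * m)‖) := by
  refine Summable.of_nat_of_neg (summable_norm_zpow_quadratic hp0 hp ha k) ?_
  refine (summable_norm_zpow_quadratic hp0 hp ha (-k)).congr fun n => ?_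
  congr 2; ring

/-! ### The conjugate Bailey pair -/

/-- The weight `(b; b)_n (-1)^n b^{n(n+1)/2}` by which a Bailey pair is summed. -/
noncomputable def baileyWeight (b : ℂ) (n : ℕ) : ℂ :=
  qPoch b b n * ((-1) ^ n * b ^ (n + 1).choose 2)

theorem baileyWeight_zero (b : ℂ) : baileyWeight b 0 = 1 := by simp [baileyWeight]

theorem baileyWeight_succ (b : ℂ) (n : ℕ) :
    baileyWeight b (n + 1) = -(baileyWeight b n * b ^ (n + 1) * (1 - b ^ (n + 1))) := by
  have e : (n + 1 + 1).choose 2 = (n + 1) + (n + 1).choose 2 := by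
    rw [Nat.choose_succ_succ' (n + 1) 1, Nat.choose_one_right]
  rw [baileyWeight, baileyWeight, qPoch_succ, e]
  ring

theorem norm_qPoch_self_le {b : ℂ} (hb : ‖b‖ < 1) (n : ℕ) : ‖qPoch b b n‖ ≤ 2 ^ n := by
  induction n with
  | zero => simp
  | succ n ih =>
    rw [qPoch_succ, norm_mul, pow_succ]
    refine mul_le_mul ih ?_ (norm_nonneg _) (by positivity)
    rw [← pow_succ]
    have h2 : ‖b ^ (n + 1)‖ ≤ 1 := by
      rw [norm_pow]; exact pow_le_one₀ (norm_nonneg _) hb.le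
    have h3 := norm_sub_le (1 : ℂ) (b ^ (n + 1))
    rw [norm_one] at h3
    linarith

/-- The quadratic exponent in the weight beats any geometric growth. -/
theorem summable_pow_mul_norm_baileyWeight {b : ℂ} (hb : ‖b‖ < 1) {K : ℝ} (hK : 0 ≤ K) :
    Summable (fun n : ℕ => K ^ n * ‖baileyWeight b n‖) := by
  refine Summable.of_nonneg_of_le (fun n => by positivity) (fun n => ?_)
    (summable_pow_mul_pow_choose (K * 2) (norm_nonneg b) hb)
  rw [baileyWeight, norm_mul, norm_mul, norm_pow, norm_pow, norm_neg, norm_one, one_pow, one_mul,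
    mul_pow, mul_assoc]
  refine mul_le_mul_of_nonneg_left ?_ (by positivity)
  refine mul_le_mul (norm_qPoch_self_le hb n) ?_ (by positivity) (by positivity)
  exact pow_le_pow_of_le_one (norm_nonneg b) hb.le (Nat.choose_le_choose 2 n.le_succ)

/-- A majorant of `baileyWeight b n * baileyKernel b s n r` that does not depend on `r`. -/
theorem exists_summable_majorant {b : ℂ} (hb : ‖b‖ < 1) (s : ℕ) :
    ∃ F : ℕ → ℝ, Summable F ∧ (∀ n, 0 ≤ F n) ∧
      ∀ n r, ‖baileyWeight b n * baileyKernel b s n r‖ ≤ F n := by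
  have h1 : 0 < 1 - ‖b‖ := sub_pos.mpr hb
  set L := (1 - ‖b‖)⁻¹ with hL
  have hL0 : 0 ≤ L := by positivity
  refine ⟨fun n => (L ^ s * L ^ s) * ((L ^ 4) ^ n * ‖baileyWeight b n‖),
    (summable_pow_mul_norm_baileyWeight hb (by positivity)).mul_left _,
    fun n => by positivity, fun n r => ?_⟩
  rw [norm_mul]
  refine (mul_le_mul_of_nonneg_left (norm_baileyKernel_le hb s n r) (norm_nonneg _)).trans
    (le_of_eq ?_)
  rw [← hL]; ring

theorem summable_baileyWeight_mul_kernel {b : ℂ} (hb : ‖b‖ < 1) (s : ℕ) (r : ℤ) :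
    Summable (fun n => baileyWeight b n * baileyKernel b s n r) := by
  obtain ⟨F, hF, -, hle⟩ := exists_summable_majorant hb s
  exact Summable.of_norm_bounded hF fun n => hle n r

/-- The conjugate Bailey sequence `γ_r = ∑_n δ_n / ((b; b)_{n - r} (b; b)_{n + r + 1})` attached to
the weight `δ_n` of `baileyWeight`. -/
noncomputable def conjugateWeight (b : ℂ) (r : ℤ) : ℂ :=
  ∑' n, baileyWeight b n * baileyKernel b 1 n r

theorem conjugateWeight_reflect (b : ℂ) (r : ℤ) :
    conjugateWeight b (-1 - r) = conjugateWeight b r := by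
  simp only [conjugateWeight, baileyKernel_reflect]

/-- The telescoping certificate behind `conjugateWeight_recurrence`. -/
theorem baileyWeight_telescope {b : ℂ} (hb0 : b ≠ 0) (hb : ‖b‖ < 1) (n : ℕ) (j : ℤ) :
    baileyWeight b n * baileyKernel b 1 n j + b ^ j * (baileyWeight b n * baileyKernel b 1 n (j - 1))
      = (1 + b ^ j) * (baileyWeight b n * baileyKernel b 0 n j)
        - (1 + b ^ j) * (baileyWeight b (n + 1) * baileyKernel b 0 (n + 1) j) := by
  have hy : b ^ j ≠ 0 := zpow_ne_zero _ hb0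
  have e1 := baileyKernel_zero_succ_mul_left hb n j
  have e2 := baileyKernel_zero_succ_mul_left hb n (-j)
  have e3 := baileyKernel_one_mul_right hb n j
  have r1 : baileyKernel b 1 n (-j) = baileyKernel b 1 n (j - 1) := by
    rw [← baileyKernel_reflect]; congr 1; ring
  have r2 : baileyKernel b 0 (n + 1) (-j) = baileyKernel b 0 (n + 1) j := by
    rw [← baileyKernel_reflect]; congr 1; ring
  rw [r1, r2] at e2
  have z1 : b ^ ((n : ℤ) + 1 - j) = b ^ (n + 1) / b ^ j := by
    rw [zpow_sub₀ hb0]; congr 1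
  have z2 : b ^ ((n : ℤ) + 1 - -j) = b ^ (n + 1) * b ^ j := by
    rw [sub_neg_eq_add, zpow_add₀ hb0]; congr 1
  have z3 : b ^ ((n : ℤ) + j + 1) = b ^ (n + 1) * b ^ j := by
    rw [← z2]; congr 1; ring
  rw [z1] at e1
  rw [z2] at e2
  rw [z3] at e3
  rw [baileyWeight_succ, ← e3, ← e2, ← e1]
  field_simp
  ring

theorem conjugateWeight_recurrence {b : ℂ} (hb0 : b ≠ 0) (hb : ‖b‖ < 1) (j : ℤ) :
    conjugateWeight b j + b ^ j * conjugateWeight b (j - 1) = (1 + b ^ j) * baileyKernel b 0 0 j := by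
  have s1 := summable_baileyWeight_mul_kernel hb 1 j
  have s2 := (summable_baileyWeight_mul_kernel hb 1 (j - 1)).mul_left (b ^ j)
  have hs := (s1.add s2).hasSum.tendsto_sum_nat
  have h0 := ((summable_baileyWeight_mul_kernel hb 0 j).mul_left (1 + b ^ j)).tendsto_atTop_zero
  simp only [Nat.cast_one, baileyWeight_telescope hb0 hb, Finset.sum_range_sub'] at hs
  have h1 := tendsto_nhds_unique hs (tendsto_const_nhds.sub h0)
  have h2 := s1.tsum_add s2
  simp only [Nat.cast_one, tsum_mul_left, baileyWeight_telescope hb0 hb] at h2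
  rw [conjugateWeight, conjugateWeight, ← h2, h1, baileyWeight_zero]
  ring

theorem conjugateWeight_natCast {b : ℂ} (hb0 : b ≠ 0) (hb : ‖b‖ < 1) (r : ℕ) :
    conjugateWeight b r = (-1) ^ r * b ^ (r + 1).choose 2 := by
  induction r with
  | zero =>
    -- At `j = 0` both terms on the left of the recurrence agree, by reflection.
    have h := conjugateWeight_recurrence hb0 hb 0
    rw [zero_sub, ← sub_zero (-1 : ℤ), conjugateWeight_reflect] at h
    have hk : baileyKernel b 0 0 0 = 1 := by simp [baileyKernel, qFactInv]
    rw [hk, zpow_zero] at h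
    simp only [Nat.cast_zero, pow_zero]
    norm_num
    linear_combination h / 2
  | succ r ih =>
    have h := conjugateWeight_recurrence hb0 hb ((r + 1 : ℕ) : ℤ)
    have hk : baileyKernel b 0 0 ((r + 1 : ℕ) : ℤ) = 0 := by
      rw [baileyKernel, qFactInv_of_neg b (by push_cast; omega), zero_mul]
    have e : (r + 1 + 1).choose 2 = (r + 1) + (r + 1).choose 2 := by
      rw [Nat.choose_succ_succ' (r + 1) 1, Nat.choose_one_right]
    rw [hk, show ((r + 1 : ℕ) : ℤ) - 1 = r by push_cast; ring, ih, zpow_natCast] at h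
    rw [e]
    linear_combination h

/-- Summing a Bailey pair against `baileyWeight`. The index `r` of the kernel is a function of the
summation index, so that pairs supported on a subset of `ℤ` are covered too. -/
theorem bailey_transform {b : ℂ} (hb : ‖b‖ < 1) {a : ℤ → ℂ} (ha : Summable (fun m => ‖a m‖))
    (r : ℤ → ℤ) :
    Summable (fun n => baileyWeight b n * ∑' m, a m * baileyKernel b 1 n (r m)) ∧
      ∑' n, baileyWeight b n * ∑' m, a m * baileyKernel b 1 n (r m) =
        ∑' m, a m * conjugateWeight b (r m) := by
  obtain ⟨F, hF, hF0, hle⟩ := exists_summable_majorant hb 1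
  have hs : Summable (Function.uncurry fun (n : ℕ) (m : ℤ) =>
      a m * (baileyWeight b n * baileyKernel b 1 n (r m))) := by
    refine Summable.of_norm_bounded (g := fun z : ℕ × ℤ => F z.1 * ‖a z.2‖)
      (hF.mul_of_nonneg ha (fun n => hF0 n) (fun m => norm_nonneg (a m))) ?_
    rintro ⟨n, m⟩
    simp only [Function.uncurry_apply_pair]
    rw [norm_mul, mul_comm]
    exact mul_le_mul_of_nonneg_right (hle n (r m)) (norm_nonneg _)
  have e : ∀ n, baileyWeight b n * ∑' m, a m * baileyKernel b 1 n (r m) =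
      ∑' m, a m * (baileyWeight b n * baileyKernel b 1 n (r m)) := fun n => by
    rw [← tsum_mul_left]; congr 1; ext m; ring
  simp only [e]
  refine ⟨hs.prod, ?_⟩
  rw [← Summable.tsum_comm hs]
  simp only [tsum_mul_left, conjugateWeight]

/-! ### Theta sums weighted by a bounded function -/

/-- The bilateral sum `∑_{m ∈ ℤ} (-1)^m p^{3m² + km} f(m)`. -/
noncomputable def thetaSum (p : ℂ) (k : ℤ) (f : ℤ → ℂ) : ℂ :=
  ∑' m : ℤ, (-1) ^ m * p ^ (3 * m ^ 2 + k * m) * f m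

theorem summable_norm_thetaWeight {p : ℂ} (hp0 : p ≠ 0) (hp : ‖p‖ < 1) (k : ℤ) :
    Summable (fun m : ℤ => ‖(-1 : ℂ) ^ m * p ^ (3 * m ^ 2 + k * m)‖) := by
  refine (summable_norm_zpow_quadratic_int hp0 hp three_ne_zero k).congr fun m => ?_
  rw [norm_mul, norm_zpow (-1 : ℂ), norm_neg, norm_one, one_zpow, one_mul]
  norm_num

theorem summable_thetaSum {p : ℂ} (hp0 : p ≠ 0) (hp : ‖p‖ < 1) (k : ℤ) {f : ℤ → ℂ} {M : ℝ}
    (hf : ∀ m, ‖f m‖ ≤ M) :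
    Summable (fun m : ℤ => (-1) ^ m * p ^ (3 * m ^ 2 + k * m) * f m) := by
  refine Summable.of_norm_bounded ((summable_norm_thetaWeight hp0 hp k).mul_right M) fun m => ?_
  rw [norm_mul]
  exact mul_le_mul_of_nonneg_left (hf m) (norm_nonneg _)

theorem thetaSum_of_eq_mul_one_sub {p : ℂ} (hp0 : p ≠ 0) (hp : ‖p‖ < 1) (k : ℤ) {f g : ℤ → ℂ}
    {M : ℝ} (hf : ∀ m, ‖f m‖ ≤ M) (c : ℂ) (j : ℤ) (h : ∀ m, f m * (1 - c * p ^ (j * m)) = g m) :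
    thetaSum p k g = thetaSum p k f - c * thetaSum p (k + j) f := by
  have s1 := summable_thetaSum hp0 hp k hf
  have s2 := (summable_thetaSum hp0 hp (k + j) hf).mul_left c
  rw [thetaSum, thetaSum, thetaSum, ← tsum_mul_left, ← s1.tsum_sub s2]
  congr 1; ext m
  have hz : p ^ (3 * m ^ 2 + (k + j) * m) = p ^ (3 * m ^ 2 + k * m) * p ^ (j * m) := by
    rw [← zpow_add₀ hp0]; congr 1; ring
  rw [← h m, hz]
  ring

theorem thetaSum_of_even (p : ℂ) (k : ℤ) {f : ℤ → ℂ} (h : ∀ m, f (-m) = f m) :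
    thetaSum p (-k) f = thetaSum p k f := by
  rw [thetaSum, thetaSum, ← (Equiv.neg ℤ).tsum_eq]
  congr 1; ext m
  simp only [Equiv.neg_apply, h]
  congr 2
  · rw [zpow_neg, ← inv_zpow, inv_neg, inv_one]
  · congr 1; ring

theorem thetaSum_of_reflect {p : ℂ} (hp0 : p ≠ 0) (k : ℤ) {f : ℤ → ℂ}
    (h : ∀ m, f (-1 - m) = f m) : thetaSum p k f = -(p ^ (3 - k) * thetaSum p (6 - k) f) := by
  rw [thetaSum, thetaSum, ← (Equiv.subLeft (-1 : ℤ)).tsum_eq, ← tsum_mul_left, ← tsum_neg]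
  congr 1; ext m
  simp only [Equiv.subLeft_apply, h]
  rw [show 3 * (-1 - m) ^ 2 + k * (-1 - m) = (3 - k) + (3 * m ^ 2 + (6 - k) * m) by ring,
    zpow_add₀ hp0, zpow_sub₀ (by norm_num), ← inv_mul_eq_div, ← inv_zpow, inv_neg, inv_one,
    zpow_neg_one, inv_neg, inv_one]
  ring

/-- Under the reflection `m ↦ -1 - m` the weight `(-1)^m p^{3m² + 3m}` is odd. -/
theorem thetaSum_three_eq_zero {p : ℂ} (hp0 : p ≠ 0) {f : ℤ → ℂ} (h : ∀ m, f (-1 - m) = f m) :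
    thetaSum p 3 f = 0 := by
  have e := thetaSum_of_reflect hp0 3 h
  norm_num at e
  exact self_eq_neg.mp e

theorem thetaSum_baileyKernel_zero (p b : ℂ) (k c : ℤ) (hc : c ≠ 0) :
    thetaSum p k (fun m => baileyKernel b 0 0 (c * m)) = 1 := by
  rw [thetaSum, tsum_eq_single 0]
  · simp [baileyKernel, qFactInv]
  · intro m hm
    have : c * m ≠ 0 := mul_ne_zero hc hm
    rcases lt_or_gt_of_ne this with h | h
    · rw [baileyKernel, qFactInv_of_neg b (k := _ + _) (by push_cast; omega), mul_zero, mul_zero]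
    · rw [baileyKernel, qFactInv_of_neg b (k := _ - _) (by push_cast; omega), zero_mul, mul_zero]

/-! ### The Bailey pairs in base `q²` -/

theorem norm_pow_lt_one {p : ℂ} (hp : ‖p‖ < 1) {n : ℕ} (hn : n ≠ 0) : ‖p ^ n‖ < 1 := by
  rw [norm_pow]; exact pow_lt_one₀ (norm_nonneg p) hp hn

theorem zpow_add_mul_eq {p : ℂ} (hp0 : p ≠ 0) (b : ℂ) (c : ℕ) (hb : b = p ^ c) {x N y : ℤ}
    {d : ℕ} (hN : N = d) (hx : x = N + y) : b ^ x = b ^ d * p ^ (c * y) := by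
  subst hb hN hx
  rw [zpow_add₀ (pow_ne_zero c hp0), zpow_natCast, zpow_mul, zpow_natCast]

/-- The three contiguity relations come from the recursion of the kernel: a factor `1 - b ^ x` with
`x` affine in `m` changes the linear exponent of the weight. -/
theorem thetaSum_kernel_one_sub {p : ℂ} (hp0 : p ≠ 0) (hp : ‖p‖ < 1) {c : ℕ} (hc : c ≠ 0)
    (d n : ℕ) (k : ℤ) :
    thetaSum p k (fun m => baileyKernel (p ^ c) 0 n (d * m)) =
      thetaSum p k (fun m => baileyKernel (p ^ c) 1 n (d * m)) -
        (p ^ c) ^ (n + 1) * thetaSum p (k + c * d) (fun m => baileyKernel (p ^ c) 1 n (d * m)) := by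
  have hb := norm_pow_lt_one hp hc
  refine thetaSum_of_eq_mul_one_sub hp0 hp k
    (fun m => norm_baileyKernel_le hb 1 n (d * m)) _ _ fun m => ?_
  rw [Nat.cast_one, ← baileyKernel_one_mul_right hb, zpow_add_mul_eq hp0 _ c rfl
    (N := n + 1) (y := d * m) (d := n + 1) (by push_cast; rfl) (by ring), mul_assoc (c : ℤ)]

theorem thetaSum_kernel_succ_sub {p : ℂ} (hp0 : p ≠ 0) (hp : ‖p‖ < 1) {c : ℕ} (hc : c ≠ 0)
    (d n : ℕ) (k : ℤ) :
    thetaSum p k (fun m => baileyKernel (p ^ c) 1 n (d * m)) =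
      thetaSum p k (fun m => baileyKernel (p ^ c) 0 (n + 1) (d * m)) -
        (p ^ c) ^ (n + 1) *
          thetaSum p (k - c * d) (fun m => baileyKernel (p ^ c) 0 (n + 1) (d * m)) := by
  have hb := norm_pow_lt_one hp hc
  rw [sub_eq_add_neg k]
  refine thetaSum_of_eq_mul_one_sub hp0 hp k
    (fun m => norm_baileyKernel_le hb 0 (n + 1) (d * m)) _ _ fun m => ?_
  rw [Nat.cast_zero, ← baileyKernel_zero_succ_mul_left hb, zpow_add_mul_eq hp0 _ c rfl
    (N := n + 1) (y := -(d * m)) (d := n + 1) (by push_cast; rfl) (by ring)]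
  congr 4; ring

theorem thetaSum_kernel_shift_sub {p : ℂ} (hp0 : p ≠ 0) (hp : ‖p‖ < 1) {c : ℕ} (hc : c ≠ 0)
    (d n : ℕ) (k : ℤ) :
    thetaSum p k (fun m => baileyKernel (p ^ c) 0 n (d * m + 1)) =
      thetaSum p k (fun m => baileyKernel (p ^ c) 1 n (d * m)) -
        (p ^ c) ^ n * thetaSum p (k - c * d) (fun m => baileyKernel (p ^ c) 1 n (d * m)) := by
  have hb := norm_pow_lt_one hp hc
  rw [sub_eq_add_neg k]
  refine thetaSum_of_eq_mul_one_sub hp0 hp k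
    (fun m => norm_baileyKernel_le hb 1 n (d * m)) _ _ fun m => ?_
  rw [Nat.cast_one, ← baileyKernel_one_mul_left hb, zpow_add_mul_eq hp0 _ c rfl
    (N := n) (y := -(d * m)) (d := n) rfl (by ring)]
  congr 4; ring

theorem thetaSum_kernel_zero_neg (p b : ℂ) (k d : ℤ) (n : ℕ) :
    thetaSum p (-k) (fun m => baileyKernel b 0 n (d * m)) =
      thetaSum p k (fun m => baileyKernel b 0 n (d * m)) :=
  thetaSum_of_even p k fun m => by
    rw [← baileyKernel_reflect b 0 n (d * m)]; congr 1; ring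

/-- The pairs in base `q² = p⁴`, relative to `1` at level `n + 1` and relative to `q²` at level `n`,
are expressed through the pair relative to `1` at level `n`. This uses the contiguity relations, the
reflection symmetries, and the vanishing of the sum with weight `(-1)^m p^{3m² + 3m}`. -/
theorem thetaSum_base_four_contiguous {p : ℂ} (hp0 : p ≠ 0) (hp : ‖p‖ < 1) (n : ℕ) :
    thetaSum p (-1) (fun m => baileyKernel (p ^ 4) 1 n m) =
        thetaSum p 1 (fun m => baileyKernel (p ^ 4) 0 n m) ∧
      thetaSum p 1 (fun m => baileyKernel (p ^ 4) 1 n m) * (1 + p ^ (4 * n + 2)) =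
        thetaSum p 1 (fun m => baileyKernel (p ^ 4) 0 n m) ∧
      thetaSum p 1 (fun m => baileyKernel (p ^ 4) 1 n m) =
        thetaSum p 1 (fun m => baileyKernel (p ^ 4) 0 (n + 1) m) * (1 - p ^ (8 * (n + 1))) := by
  have a1 := thetaSum_kernel_one_sub hp0 hp four_ne_zero 1 n (-1)
  have a2 := thetaSum_kernel_one_sub hp0 hp four_ne_zero 1 n 1
  have a3 := thetaSum_kernel_succ_sub hp0 hp four_ne_zero 1 n 1
  have a4 := thetaSum_kernel_succ_sub hp0 hp four_ne_zero 1 n 3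
  have t1 := thetaSum_kernel_zero_neg p (p ^ 4) 1 1 n
  have t2 := thetaSum_kernel_zero_neg p (p ^ 4) 1 1 (n + 1)
  have t3 := thetaSum_kernel_zero_neg p (p ^ 4) 3 1 (n + 1)
  have hr : ∀ m : ℤ, baileyKernel (p ^ 4) 1 n (-1 - m) = baileyKernel (p ^ 4) 1 n m :=
    baileyKernel_reflect (p ^ 4) 1 n
  have s1 := thetaSum_of_reflect hp0 1 hr
  have s3 := thetaSum_three_eq_zero hp0 hr
  norm_num at a1 a2 a3 a4 t1 t2 t3 s1
  rw [s3] at a1 a4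
  rw [t1] at a1
  rw [t3] at a3
  refine ⟨by linear_combination -a1, ?_, ?_⟩
  · rw [a2]
    linear_combination p ^ (4 * n + 2) * s1
  · linear_combination a3 + (p ^ 4) ^ (n + 1) * a4 - (p ^ 4) ^ (n + 1) * (p ^ 4) ^ (n + 1) * t2

theorem qPoch_neg_self_ne_zero {q : ℂ} (hq : ‖q‖ < 1) (n : ℕ) : qPoch (-q) q n ≠ 0 := by
  refine Finset.prod_ne_zero_iff.mpr fun i _ => ?_
  rw [mul_neg, sub_neg_eq_add, ← pow_succ]
  exact one_add_pow_ne_zero hq i.succ_ne_zero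

theorem qPoch_odd_ne_zero {q : ℂ} (hq : ‖q‖ < 1) (n : ℕ) : qPoch q (q ^ 2) n ≠ 0 := by
  refine Finset.prod_ne_zero_iff.mpr fun i _ => ?_
  rw [← pow_mul, ← pow_succ]
  exact one_sub_pow_ne_zero hq (2 * i).succ_ne_zero

theorem thetaSum_base_four_zero {p : ℂ} (hp0 : p ≠ 0) (hp : ‖p‖ < 1) (n : ℕ) :
    thetaSum p 1 (fun m => baileyKernel (p ^ 4) 0 n m) =
      (qPoch (p ^ 4) (p ^ 4) n * qPoch (-p ^ 2) (p ^ 2) (2 * n))⁻¹ := by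
  induction n with
  | zero => simpa using thetaSum_baileyKernel_zero p (p ^ 4) 1 1 one_ne_zero
  | succ n ih =>
    obtain ⟨-, h1, h2⟩ := thetaSum_base_four_contiguous hp0 hp n
    rw [ih, h2] at h1
    have n1 := qPoch_self_ne_zero (norm_pow_lt_one hp four_ne_zero) n
    have n2 := qPoch_neg_self_ne_zero (norm_pow_lt_one hp two_ne_zero) (2 * n)
    have n3 := qPoch_self_ne_zero (norm_pow_lt_one hp four_ne_zero) (n + 1)
    have n4 := qPoch_neg_self_ne_zero (norm_pow_lt_one hp two_ne_zero) (2 * (n + 1))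
    rw [← mul_eq_one_iff_eq_inv₀ (mul_ne_zero n1 n2)] at h1
    rw [← mul_eq_one_iff_eq_inv₀ (mul_ne_zero n3 n4), ← h1,
      show 2 * (n + 1) = 2 * n + 1 + 1 by ring, qPoch_succ, qPoch_succ, qPoch_succ]
    ring

theorem thetaSum_base_four_neg_one {p : ℂ} (hp0 : p ≠ 0) (hp : ‖p‖ < 1) (n : ℕ) :
    thetaSum p (-1) (fun m => baileyKernel (p ^ 4) 1 n m) =
      (qPoch (p ^ 4) (p ^ 4) n * qPoch (-p ^ 2) (p ^ 2) (2 * n))⁻¹ := by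
  rw [(thetaSum_base_four_contiguous hp0 hp n).1, thetaSum_base_four_zero hp0 hp]

theorem thetaSum_base_four_one {p : ℂ} (hp0 : p ≠ 0) (hp : ‖p‖ < 1) (n : ℕ) :
    thetaSum p 1 (fun m => baileyKernel (p ^ 4) 1 n m) =
      (qPoch (p ^ 4) (p ^ 4) n * qPoch (-p ^ 2) (p ^ 2) (2 * n + 1))⁻¹ := by
  have h := (thetaSum_base_four_contiguous hp0 hp n).2.1
  have n1 := qPoch_self_ne_zero (norm_pow_lt_one hp four_ne_zero) n
  have n2 := qPoch_neg_self_ne_zero (norm_pow_lt_one hp two_ne_zero) (2 * n)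
  have n3 := qPoch_neg_self_ne_zero (norm_pow_lt_one hp two_ne_zero) (2 * n + 1)
  rw [thetaSum_base_four_zero hp0 hp, ← mul_eq_one_iff_eq_inv₀ (mul_ne_zero n1 n2)] at h
  rw [← mul_eq_one_iff_eq_inv₀ (mul_ne_zero n1 n3), ← h, qPoch_succ]
  ring

/-! ### The Bailey pairs in base `q` -/

/-- The analogue of `thetaSum_base_four_contiguous` in base `q`, for pairs supported on the even
integers. -/
theorem thetaSum_even_contiguous {q : ℂ} (hq0 : q ≠ 0) (hq : ‖q‖ < 1) (n : ℕ) :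
    thetaSum q 3 (fun m => baileyKernel q 1 n (2 * m)) =
        q ^ n * thetaSum q 1 (fun m => baileyKernel q 1 n (2 * m)) ∧
      thetaSum q 1 (fun m => baileyKernel q 1 n (2 * m)) * (1 - q ^ (2 * n + 1)) =
        thetaSum q 1 (fun m => baileyKernel q 0 n (2 * m)) ∧
      thetaSum q 1 (fun m => baileyKernel q 1 n (2 * m)) =
        thetaSum q 1 (fun m => baileyKernel q 0 (n + 1) (2 * m)) * (1 - q ^ (n + 1)) := by
  have a1 := thetaSum_kernel_one_sub hq0 hq one_ne_zero 2 n 1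
  have a2 := thetaSum_kernel_succ_sub hq0 hq one_ne_zero 2 n 1
  have a3 := thetaSum_kernel_shift_sub hq0 hq one_ne_zero 2 n 3
  have t := thetaSum_kernel_zero_neg q q 1 2 (n + 1)
  have v : thetaSum q 3 (fun m => baileyKernel q 0 n (2 * m + 1)) = 0 :=
    thetaSum_three_eq_zero hq0 fun m => by
      rw [← baileyKernel_reflect q 0 n (2 * m + 1)]; congr 1; ring
  norm_num at a1 a2 a3
  rw [v] at a3
  rw [t] at a2
  have h3 : thetaSum q 3 (fun m => baileyKernel q 1 n (2 * m)) =
      q ^ n * thetaSum q 1 (fun m => baileyKernel q 1 n (2 * m)) := by linear_combination -a3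
  refine ⟨h3, ?_, by linear_combination a2⟩
  rw [a1, h3]
  ring

theorem thetaSum_even_zero {q : ℂ} (hq0 : q ≠ 0) (hq : ‖q‖ < 1) (n : ℕ) :
    thetaSum q 1 (fun m => baileyKernel q 0 n (2 * m)) =
      (qPoch q q n * qPoch q (q ^ 2) n)⁻¹ := by
  induction n with
  | zero => simpa using thetaSum_baileyKernel_zero q q 1 2 two_ne_zero
  | succ n ih =>
    obtain ⟨-, h1, h2⟩ := thetaSum_even_contiguous hq0 hq n
    rw [ih, h2, ← mul_eq_one_iff_eq_inv₀ (mul_ne_zero (qPoch_self_ne_zero hq n)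
      (qPoch_odd_ne_zero hq n))] at h1
    rw [← mul_eq_one_iff_eq_inv₀ (mul_ne_zero (qPoch_self_ne_zero hq _) (qPoch_odd_ne_zero hq _)),
      ← h1, qPoch_succ, qPoch_succ]
    ring

theorem thetaSum_even_one {q : ℂ} (hq0 : q ≠ 0) (hq : ‖q‖ < 1) (n : ℕ) :
    thetaSum q 1 (fun m => baileyKernel q 1 n (2 * m)) =
      (qPoch q q n * qPoch q (q ^ 2) (n + 1))⁻¹ := by
  have h := (thetaSum_even_contiguous hq0 hq n).2.1
  rw [thetaSum_even_zero hq0 hq, ← mul_eq_one_iff_eq_inv₀ (mul_ne_zero (qPoch_self_ne_zero hq n)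
      (qPoch_odd_ne_zero hq n))] at h
  rw [← mul_eq_one_iff_eq_inv₀ (mul_ne_zero (qPoch_self_ne_zero hq _) (qPoch_odd_ne_zero hq _)),
    ← h, qPoch_succ q (q ^ 2)]
  ring

theorem thetaSum_even_three {q : ℂ} (hq0 : q ≠ 0) (hq : ‖q‖ < 1) (n : ℕ) :
    thetaSum q 3 (fun m => baileyKernel q 1 n (2 * m)) =
      q ^ n * (qPoch q q n * qPoch q (q ^ 2) (n + 1))⁻¹ := by
  rw [(thetaSum_even_contiguous hq0 hq n).1, thetaSum_even_one hq0 hq]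

/-! ### Theta sums over the natural numbers -/

theorem two_mul_choose_succ_two (n : ℕ) : 2 * (n + 1).choose 2 = n * (n + 1) := by
  rw [Nat.choose_two_right, Nat.mul_div_cancel' (Nat.even_mul_pred_self _).two_dvd,
    Nat.add_sub_cancel, mul_comm]

theorem summable_quintic_theta {p : ℂ} (hp0 : p ≠ 0) (hp : ‖p‖ < 1) (k : ℤ) :
    Summable (fun n : ℕ => p ^ (5 * (n : ℤ) ^ 2 + k * n)) := by
  have h := summable_norm_zpow_quadratic hp0 hp (a := 5) (by norm_num) k
  exact Summable.of_norm (by simpa using h)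

theorem summable_alternating_quintic_theta {p : ℂ} (hp0 : p ≠ 0) (hp : ‖p‖ < 1) (k : ℤ) :
    Summable (fun n : ℕ => (-1) ^ n * p ^ (5 * (n : ℤ) ^ 2 + k * n)) := by
  have h := summable_norm_zpow_quadratic hp0 hp (a := 5) (by norm_num) k
  refine Summable.of_norm (h.congr fun n => ?_)
  simp

theorem pow_four_pow_choose (p : ℂ) (n : ℕ) :
    (p ^ 4) ^ (n + 1).choose 2 = p ^ (2 * (n : ℤ) ^ 2 + 2 * n) := by
  have h : 2 * (n : ℤ) ^ 2 + 2 * n = ((4 * (n + 1).choose 2 : ℕ) : ℤ) := by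
    have := two_mul_choose_succ_two n
    zify at this ⊢
    linear_combination -2 * this
  rw [h, zpow_natCast, pow_mul]

theorem neg_one_pow_mul_self (n : ℕ) : (-1 : ℂ) ^ n * (-1) ^ n = 1 := by
  rw [← mul_pow]; norm_num

theorem tsum_thetaWeight_mul_conjugateWeight_base_four {p : ℂ} (hp0 : p ≠ 0) (hp : ‖p‖ < 1)
    (k : ℤ) :
    ∑' m : ℤ, (-1) ^ m * p ^ (3 * m ^ 2 + k * m) * conjugateWeight (p ^ 4) m =
      ∑' n : ℕ, p ^ (5 * (n : ℤ) ^ 2 + (k + 2) * n) -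
        p ^ (3 - k) * ∑' n : ℕ, p ^ (5 * (n : ℤ) ^ 2 + (8 - k) * n) := by
  have hb0 := pow_ne_zero 4 hp0
  have hb := norm_pow_lt_one hp four_ne_zero
  have e1 : (fun n : ℕ => (-1 : ℂ) ^ (n : ℤ) * p ^ (3 * (n : ℤ) ^ 2 + k * n) *
      conjugateWeight (p ^ 4) n) = fun n : ℕ => p ^ (5 * (n : ℤ) ^ 2 + (k + 2) * n) := by
    ext n
    rw [conjugateWeight_natCast hb0 hb, pow_four_pow_choose, zpow_natCast,
      show 5 * (n : ℤ) ^ 2 + (k + 2) * n = (3 * (n : ℤ) ^ 2 + k * n) + (2 * (n : ℤ) ^ 2 + 2 * n) by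
        ring, zpow_add₀ hp0 (3 * (n : ℤ) ^ 2 + k * n)]
    linear_combination p ^ (3 * (n : ℤ) ^ 2 + k * n) * p ^ (2 * (n : ℤ) ^ 2 + 2 * n) *
      neg_one_pow_mul_self n
  have e2 : (fun n : ℕ => (-1 : ℂ) ^ (-((n : ℤ) + 1)) *
      p ^ (3 * (-((n : ℤ) + 1)) ^ 2 + k * (-((n : ℤ) + 1))) *
      conjugateWeight (p ^ 4) (-((n : ℤ) + 1))) =
      fun n : ℕ => -p ^ (3 - k) * p ^ (5 * (n : ℤ) ^ 2 + (8 - k) * n) := by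
    ext n
    have hc : conjugateWeight (p ^ 4) (-((n : ℤ) + 1)) = conjugateWeight (p ^ 4) n := by
      rw [← conjugateWeight_reflect]; congr 1; ring
    have hs : (-1 : ℂ) ^ (-((n : ℤ) + 1)) = -(-1) ^ n := by
      rw [zpow_neg, ← inv_zpow, inv_neg, inv_one, zpow_add_one₀ (by norm_num), zpow_natCast]
      ring
    have hz : p ^ (3 * (-((n : ℤ) + 1)) ^ 2 + k * (-((n : ℤ) + 1))) * p ^ (2 * (n : ℤ) ^ 2 + 2 * n) =
        p ^ (3 - k) * p ^ (5 * (n : ℤ) ^ 2 + (8 - k) * n) := by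
      rw [← zpow_add₀ hp0, ← zpow_add₀ hp0]; congr 1; ring
    rw [hc, conjugateWeight_natCast hb0 hb, pow_four_pow_choose, hs]
    linear_combination (-(-1 : ℂ) ^ n * (-1) ^ n) * hz -
      p ^ (3 - k) * p ^ (5 * (n : ℤ) ^ 2 + (8 - k) * n) * neg_one_pow_mul_self n
  rw [tsum_of_nat_of_neg_add_one, e1, e2, tsum_mul_left, neg_mul, ← sub_eq_add_neg]
  · rw [e1]; exact summable_quintic_theta hp0 hp _
  · rw [e2]; exact (summable_quintic_theta hp0 hp _).mul_left _

theorem tsum_thetaWeight_mul_conjugateWeight_even {q : ℂ} (hq0 : q ≠ 0) (hq : ‖q‖ < 1)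
    (k : ℤ) :
    ∑' m : ℤ, (-1) ^ m * q ^ (3 * m ^ 2 + k * m) * conjugateWeight q (2 * m) =
      ∑' n : ℕ, (-1) ^ n * q ^ (5 * (n : ℤ) ^ 2 + (k + 1) * n) +
        q ^ (4 - k) * ∑' n : ℕ, (-1) ^ n * q ^ (5 * (n : ℤ) ^ 2 + (9 - k) * n) := by
  have e1 : (fun n : ℕ => (-1 : ℂ) ^ (n : ℤ) * q ^ (3 * (n : ℤ) ^ 2 + k * n) *
      conjugateWeight q (2 * n)) =
      fun n : ℕ => (-1) ^ n * q ^ (5 * (n : ℤ) ^ 2 + (k + 1) * n) := by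
    ext n
    have hc : conjugateWeight q (2 * n) = q ^ (2 * (n : ℤ) ^ 2 + n) := by
      have h1 := conjugateWeight_natCast hq0 hq (2 * n)
      have h2 : (2 * n + 1).choose 2 = 2 * n ^ 2 + n := by
        have := two_mul_choose_succ_two (2 * n)
        nlinarith
      rw [h2, pow_mul, neg_one_sq, one_pow, one_mul] at h1
      exact_mod_cast h1
    rw [hc, zpow_natCast, mul_assoc, ← zpow_add₀ hq0]
    congr 2; ring
  have e2 : (fun n : ℕ => (-1 : ℂ) ^ (-((n : ℤ) + 1)) *
      q ^ (3 * (-((n : ℤ) + 1)) ^ 2 + k * (-((n : ℤ) + 1))) *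
      conjugateWeight q (2 * -((n : ℤ) + 1))) =
      fun n : ℕ => q ^ (4 - k) * ((-1) ^ n * q ^ (5 * (n : ℤ) ^ 2 + (9 - k) * n)) := by
    ext n
    have hc : conjugateWeight q (2 * -((n : ℤ) + 1)) = -q ^ (2 * (n : ℤ) ^ 2 + 3 * n + 1) := by
      have h1 := conjugateWeight_natCast hq0 hq (2 * n + 1)
      have h2 : (2 * n + 1 + 1).choose 2 = 2 * n ^ 2 + 3 * n + 1 := by
        have := two_mul_choose_succ_two (2 * n + 1)
        nlinarith
      rw [h2, pow_succ (-1 : ℂ), pow_mul, neg_one_sq, one_pow, one_mul, neg_one_mul] at h1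
      rw [← conjugateWeight_reflect,
        show -1 - 2 * -((n : ℤ) + 1) = ((2 * n + 1 : ℕ) : ℤ) by push_cast; ring, h1]
      norm_cast
    have hs : (-1 : ℂ) ^ (-((n : ℤ) + 1)) = -(-1) ^ n := by
      rw [zpow_neg, ← inv_zpow, inv_neg, inv_one, zpow_add_one₀ (by norm_num), zpow_natCast]
      ring
    have hz : q ^ (3 * (-((n : ℤ) + 1)) ^ 2 + k * (-((n : ℤ) + 1))) *
        q ^ (2 * (n : ℤ) ^ 2 + 3 * n + 1) =
        q ^ (4 - k) * q ^ (5 * (n : ℤ) ^ 2 + (9 - k) * n) := by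
      rw [← zpow_add₀ hq0, ← zpow_add₀ hq0]; congr 1; ring
    rw [hc, hs]
    linear_combination (-1 : ℂ) ^ n * hz
  rw [tsum_of_nat_of_neg_add_one, e1, e2, tsum_mul_left]
  · rw [e1]; exact summable_alternating_quintic_theta hq0 hq _
  · rw [e2]; exact (summable_alternating_quintic_theta hq0 hq _).mul_left _

/-- Summation of the pairs in base `q² = p⁴`. -/
theorem bailey_sum_base_four {p : ℂ} (hp0 : p ≠ 0) (hp : ‖p‖ < 1) (k : ℤ) {N : ℕ → ℕ}
    (hβ : ∀ n, thetaSum p k (fun m => baileyKernel (p ^ 4) 1 n m) =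
      (qPoch (p ^ 4) (p ^ 4) n * qPoch (-p ^ 2) (p ^ 2) (N n))⁻¹) :
    HasSum (fun n : ℕ => (-1) ^ n * (p ^ 2) ^ (n * (n + 1)) / qPoch (-p ^ 2) (p ^ 2) (N n))
      (∑' n : ℕ, p ^ (5 * (n : ℤ) ^ 2 + (k + 2) * n) -
        p ^ (3 - k) * ∑' n : ℕ, p ^ (5 * (n : ℤ) ^ 2 + (8 - k) * n)) := by
  have hb := norm_pow_lt_one hp four_ne_zero
  obtain ⟨h1, h2⟩ := bailey_transform hb (summable_norm_thetaWeight hp0 hp k) (fun m => m)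
  rw [← tsum_thetaWeight_mul_conjugateWeight_base_four hp0 hp, ← h2]
  convert h1.hasSum using 1
  ext n
  have h3 := hβ n
  rw [thetaSum] at h3
  rw [h3, baileyWeight, mul_inv, ← two_mul_choose_succ_two, pow_mul, ← pow_mul p,
    div_eq_mul_inv]
  field_simp [qPoch_self_ne_zero hb n]

/-- Summation of the pairs in base `q`. -/
theorem bailey_sum_even {q : ℂ} (hq0 : q ≠ 0) (hq : ‖q‖ < 1) (k : ℤ) {j : ℕ → ℕ}
    (hβ : ∀ n, thetaSum q k (fun m => baileyKernel q 1 n (2 * m)) =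
      q ^ j n * (qPoch q q n * qPoch q (q ^ 2) (n + 1))⁻¹) :
    HasSum (fun n : ℕ => (-1) ^ n * q ^ ((n + 1).choose 2 + j n) / qPoch q (q ^ 2) (n + 1))
      (∑' n : ℕ, (-1) ^ n * q ^ (5 * (n : ℤ) ^ 2 + (k + 1) * n) +
        q ^ (4 - k) * ∑' n : ℕ, (-1) ^ n * q ^ (5 * (n : ℤ) ^ 2 + (9 - k) * n)) := by
  obtain ⟨h1, h2⟩ := bailey_transform hq (summable_norm_thetaWeight hq0 hq k) (fun m => 2 * m)
  rw [← tsum_thetaWeight_mul_conjugateWeight_even hq0 hq, ← h2]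
  convert h1.hasSum using 1
  ext n
  have h3 := hβ n
  rw [thetaSum] at h3
  rw [h3, baileyWeight, mul_inv, pow_add, div_eq_mul_inv]
  field_simp [qPoch_self_ne_zero hq n]

/-! ### Replacing `q` by `q⁻¹` -/

theorem qPoch_odd_inv {q : ℂ} (hq0 : q ≠ 0) (n : ℕ) :
    qPoch q⁻¹ (q⁻¹ ^ 2) n * q ^ n ^ 2 = (-1) ^ n * qPoch q (q ^ 2) n := by
  induction n with
  | zero => simp
  | succ n ih =>
    have h : (1 - (q⁻¹ ^ 2) ^ n * q⁻¹) * q ^ (2 * n + 1) = -(1 - (q ^ 2) ^ n * q) := by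
      rw [← pow_mul, ← pow_mul, ← pow_succ, ← pow_succ, inv_pow, sub_mul,
        inv_mul_cancel₀ (pow_ne_zero _ hq0)]
      ring
    rw [qPoch_succ, qPoch_succ, show (n + 1) ^ 2 = n ^ 2 + (2 * n + 1) by ring, pow_add q,
      pow_succ (-1 : ℂ)]
    linear_combination (1 - (q⁻¹ ^ 2) ^ n * q⁻¹) * q ^ (2 * n + 1) * ih +
      (-1) ^ n * qPoch q (q ^ 2) n * h

theorem qPoch_neg_inv {q : ℂ} (hq0 : q ≠ 0) (n : ℕ) :
    qPoch (-q⁻¹) q⁻¹ n * q ^ (n + 1).choose 2 = qPoch (-q) q n := by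
  induction n with
  | zero => simp
  | succ n ih =>
    have h : (1 - q⁻¹ ^ n * -q⁻¹) * q ^ (n + 1) = 1 - q ^ n * -q := by
      rw [mul_neg, mul_neg, ← pow_succ, ← pow_succ, inv_pow, sub_neg_eq_add, add_mul,
        inv_mul_cancel₀ (pow_ne_zero _ hq0)]
      ring
    rw [qPoch_succ, qPoch_succ, Nat.choose_succ_succ' (n + 1) 1, Nat.choose_one_right, pow_add q,
      ← h, ← ih]
    ring

theorem inv_div_eq_of_mul_eq {t s a c Q Q' : ℂ} (ha : a ≠ 0) (hQ : Q ≠ 0)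
    (hs : s * s = 1) (h : Q' * (a * c) = s * Q) : t * a⁻¹ / Q' = t * s * c / Q := by
  have hs0 : s ≠ 0 := fun h0 => by simp [h0] at hs
  have hQ' : Q' ≠ 0 := fun h0 => by
    rw [h0, zero_mul] at h
    exact mul_ne_zero hs0 hQ h.symm
  rw [div_eq_div_iff hQ' hQ]
  field_simp
  linear_combination -t * s * h - t * Q * hs

theorem choose_add_choose_succ (n : ℕ) : (n + 1).choose 2 + (n + 2).choose 2 = (n + 1) ^ 2 := by
  have h1 := two_mul_choose_succ_two n
  have h2 := two_mul_choose_succ_two (n + 1)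
  nlinarith

theorem tenthPhiTerm_inv {q : ℂ} (hq0 : q ≠ 0) (hq : ‖q‖ < 1) (n : ℕ) :
    tenthPhiTerm q⁻¹ n = (-1) ^ (n + 1) * q ^ (n + 2).choose 2 / qPoch q (q ^ 2) (n + 1) := by
  rw [tenthPhiTerm, inv_pow q ((n + 1).choose 2)]
  have h := inv_div_eq_of_mul_eq (t := 1) (c := q ^ (n + 2).choose 2)
    (pow_ne_zero ((n + 1).choose 2) hq0) (qPoch_odd_ne_zero hq (n + 1))
    (neg_one_pow_mul_self (n + 1)) (Q' := qPoch q⁻¹ (q⁻¹ ^ 2) (n + 1))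
    (by rw [← pow_add, choose_add_choose_succ, qPoch_odd_inv hq0])
  simpa only [one_mul] using h

theorem tenthPsiTerm_inv {q : ℂ} (hq0 : q ≠ 0) (hq : ‖q‖ < 1) (n : ℕ) :
    tenthPsiTerm q⁻¹ n = (-1) ^ (n + 1) * q ^ (n + 1).choose 2 / qPoch q (q ^ 2) (n + 1) := by
  rw [tenthPsiTerm, inv_pow q ((n + 2).choose 2)]
  have h := inv_div_eq_of_mul_eq (t := 1) (c := q ^ (n + 1).choose 2)
    (pow_ne_zero ((n + 2).choose 2) hq0) (qPoch_odd_ne_zero hq (n + 1))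
    (neg_one_pow_mul_self (n + 1)) (Q' := qPoch q⁻¹ (q⁻¹ ^ 2) (n + 1))
    (by rw [← pow_add, add_comm (Nat.choose _ _), choose_add_choose_succ, qPoch_odd_inv hq0])
  simpa only [one_mul] using h

theorem tenthXTerm_inv {q : ℂ} (hq0 : q ≠ 0) (hq : ‖q‖ < 1) (n : ℕ) :
    tenthXTerm q⁻¹ n = (-1) ^ n * q ^ (n * (n + 1)) / qPoch (-q) q (2 * n) := by
  rw [tenthXTerm, inv_pow q (n ^ 2)]
  have e : n ^ 2 + n * (n + 1) = (2 * n + 1).choose 2 := by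
    have := two_mul_choose_succ_two (2 * n)
    nlinarith
  have h := inv_div_eq_of_mul_eq (t := (-1) ^ n) (c := q ^ (n * (n + 1)))
    (pow_ne_zero (n ^ 2) hq0) (qPoch_neg_self_ne_zero hq (2 * n))
    (one_mul 1) (Q' := qPoch (-q⁻¹) q⁻¹ (2 * n))
    (by rw [← pow_add, e, qPoch_neg_inv hq0, one_mul])
  rwa [mul_one] at h

theorem tenthChiTerm_inv {q : ℂ} (hq0 : q ≠ 0) (hq : ‖q‖ < 1) (n : ℕ) :
    tenthChiTerm q⁻¹ n = (-1) ^ n * q ^ (n * (n + 1)) / qPoch (-q) q (2 * n + 1) := by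
  rw [tenthChiTerm, inv_pow q ((n + 1) ^ 2)]
  have e : (n + 1) ^ 2 + n * (n + 1) = (2 * n + 1 + 1).choose 2 := by
    have := two_mul_choose_succ_two (2 * n + 1)
    nlinarith
  have h := inv_div_eq_of_mul_eq (t := (-1) ^ n) (c := q ^ (n * (n + 1)))
    (pow_ne_zero ((n + 1) ^ 2) hq0) (qPoch_neg_self_ne_zero hq (2 * n + 1))
    (one_mul 1) (Q' := qPoch (-q⁻¹) q⁻¹ (2 * n + 1))
    (by rw [← pow_add, e, qPoch_neg_inv hq0, one_mul])
  rwa [mul_one] at h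

/-! ### The four identities -/

theorem zpow_mul_pow_five {q : ℂ} (hq0 : q ≠ 0) (k : ℤ) (n : ℕ) :
    q ^ k * q ^ (5 * n * (n + 1)) = q ^ (5 * (n : ℤ) ^ 2 + (5 * n + k)) := by
  rw [← zpow_natCast, ← zpow_add₀ hq0]
  congr 1; push_cast; ring

theorem sq_zpow_mul_pow_five_half {p : ℂ} (hp0 : p ≠ 0) (k : ℤ) (n : ℕ) :
    (p ^ 2) ^ k * (p ^ 2) ^ (5 * n * (n + 1) / 2) = p ^ (5 * (n : ℤ) ^ 2 + (5 * n + 2 * k)) := by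
  have h2 : 2 ∣ 5 * n * (n + 1) := by
    rw [mul_assoc]; exact (Nat.even_mul_succ_self n).two_dvd.mul_left 5
  rw [← pow_mul, Nat.mul_div_cancel' h2, ← zpow_natCast p (5 * n * (n + 1)), ← zpow_natCast p 2,
    ← zpow_mul, ← zpow_add₀ hp0]
  congr 1; push_cast; ring

theorem phi_inv_hasSum {q : ℂ} (hq0 : q ≠ 0) (hq : ‖q‖ < 1) :
    HasSum (fun n : ℕ => (-1) ^ (n + 1) * q ^ (n + 2).choose 2 / qPoch q (q ^ 2) (n + 1))
      (-q * (∑' n : ℕ, (-1) ^ n * q ^ (5 * (n : ℤ) ^ 2 + 4 * n)) -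
        q ^ 2 * ∑' n : ℕ, (-1) ^ n * q ^ (5 * (n : ℤ) ^ 2 + 6 * n)) := by
  have h := (bailey_sum_even hq0 hq 3 (j := fun n => n)
    (thetaSum_even_three hq0 hq)).mul_left (-q)
  norm_num only [zpow_one] at h
  have e (n : ℕ) : (-1) ^ (n + 1) * q ^ (n + 2).choose 2 / qPoch q (q ^ 2) (n + 1) =
      -q * ((-1) ^ n * q ^ ((n + 1).choose 2 + n) / qPoch q (q ^ 2) (n + 1)) := by
    rw [Nat.choose_succ_succ' (n + 1) 1, Nat.choose_one_right]
    ring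
  have v (A B : ℂ) : -q * A - q ^ 2 * B = -q * (A + q * B) := by ring
  rw [funext e, v]
  exact h

theorem psi_inv_hasSum {q : ℂ} (hq0 : q ≠ 0) (hq : ‖q‖ < 1) :
    HasSum (fun n : ℕ => (-1) ^ (n + 1) * q ^ (n + 1).choose 2 / qPoch q (q ^ 2) (n + 1))
      (-(∑' n : ℕ, (-1) ^ n * q ^ (5 * (n : ℤ) ^ 2 + 2 * n)) -
        q ^ 3 * ∑' n : ℕ, (-1) ^ n * q ^ (5 * (n : ℤ) ^ 2 + 8 * n)) := by
  have h := (bailey_sum_even hq0 hq 1 (j := fun _ => 0)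
    (fun n => by rw [thetaSum_even_one hq0 hq, pow_zero, one_mul])).neg
  norm_num only [add_zero] at h
  have e (n : ℕ) : (-1) ^ (n + 1) * q ^ (n + 1).choose 2 / qPoch q (q ^ 2) (n + 1) =
      -((-1) ^ n * q ^ (n + 1).choose 2 / qPoch q (q ^ 2) (n + 1)) := by
    ring
  rw [funext e, ← neg_add']
  exact_mod_cast h

theorem X_inv_hasSum {p : ℂ} (hp0 : p ≠ 0) (hp : ‖p‖ < 1) :
    HasSum (fun n : ℕ => (-1) ^ n * (p ^ 2) ^ (n * (n + 1)) / qPoch (-p ^ 2) (p ^ 2) (2 * n))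
      (∑' n : ℕ, p ^ (5 * (n : ℤ) ^ 2 + 1 * n) -
        (p ^ 2) ^ 2 * ∑' n : ℕ, p ^ (5 * (n : ℤ) ^ 2 + 9 * n)) := by
  have h := bailey_sum_base_four hp0 hp (-1) (thetaSum_base_four_neg_one hp0 hp)
  norm_num at h ⊢
  convert h using 3
  ring

theorem chi_inv_hasSum {p : ℂ} (hp0 : p ≠ 0) (hp : ‖p‖ < 1) :
    HasSum (fun n : ℕ => (-1) ^ n * (p ^ 2) ^ (n * (n + 1)) / qPoch (-p ^ 2) (p ^ 2) (2 * n + 1))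
      (∑' n : ℕ, p ^ (5 * (n : ℤ) ^ 2 + 3 * n) -
        p ^ 2 * ∑' n : ℕ, p ^ (5 * (n : ℤ) ^ 2 + 7 * n)) := by
  have h := bailey_sum_base_four hp0 hp 1 (thetaSum_base_four_one hp0 hp)
  norm_num at h
  convert h using 3

theorem mainTheorem1 (q : ℂ) (hq0 : q ≠ 0) (hq1 : ‖q‖ < 1) :
    ((∀ n : ℕ, tenthPhiTerm q⁻¹ n = (-1) ^ (n + 1) * q ^ (n + 2).choose 2 / qPoch q (q ^ 2) (n + 1)) ∧
      Summable (fun n : ℕ => (-1) ^ (n + 1) * q ^ (n + 2).choose 2 / qPoch q (q ^ 2) (n + 1)) ∧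
      Summable (fun n : ℕ => (-1) ^ n * q ^ (-n : ℤ) * q ^ (5 * n * (n + 1))) ∧
      Summable (fun n : ℕ => (-1) ^ n * q ^ (n : ℤ) * q ^ (5 * n * (n + 1))) ∧
      ∑' n : ℕ, (-1) ^ (n + 1) * q ^ (n + 2).choose 2 / qPoch q (q ^ 2) (n + 1) =
        -q * (∑' n : ℕ, (-1) ^ n * q ^ (-n : ℤ) * q ^ (5 * n * (n + 1))) -
          q ^ 2 * ∑' n : ℕ, (-1) ^ n * q ^ (n : ℤ) * q ^ (5 * n * (n + 1))) ∧
    ((∀ n : ℕ, tenthPsiTerm q⁻¹ n = (-1) ^ (n + 1) * q ^ (n + 1).choose 2 / qPoch q (q ^ 2) (n + 1)) ∧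
      Summable (fun n : ℕ => (-1) ^ (n + 1) * q ^ (n + 1).choose 2 / qPoch q (q ^ 2) (n + 1)) ∧
      Summable (fun n : ℕ => (-1) ^ n * q ^ (-3 * n : ℤ) * q ^ (5 * n * (n + 1))) ∧
      Summable (fun n : ℕ => (-1) ^ n * q ^ (3 * n : ℤ) * q ^ (5 * n * (n + 1))) ∧
      ∑' n : ℕ, (-1) ^ (n + 1) * q ^ (n + 1).choose 2 / qPoch q (q ^ 2) (n + 1) =
        -(∑' n : ℕ, (-1) ^ n * q ^ (-3 * n : ℤ) * q ^ (5 * n * (n + 1))) -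
          q ^ 3 * ∑' n : ℕ, (-1) ^ n * q ^ (3 * n : ℤ) * q ^ (5 * n * (n + 1))) ∧
    ((∀ n : ℕ, tenthXTerm q⁻¹ n = (-1) ^ n * q ^ (n * (n + 1)) / qPoch (-q) q (2 * n)) ∧
      Summable (fun n : ℕ => (-1) ^ n * q ^ (n * (n + 1)) / qPoch (-q) q (2 * n)) ∧
      Summable (fun n : ℕ => q ^ (-2 * n : ℤ) * q ^ (5 * n * (n + 1) / 2)) ∧
      Summable (fun n : ℕ => q ^ (2 * n : ℤ) * q ^ (5 * n * (n + 1) / 2)) ∧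
      ∑' n : ℕ, (-1) ^ n * q ^ (n * (n + 1)) / qPoch (-q) q (2 * n) =
        (∑' n : ℕ, q ^ (-2 * n : ℤ) * q ^ (5 * n * (n + 1) / 2)) -
          q ^ 2 * ∑' n : ℕ, q ^ (2 * n : ℤ) * q ^ (5 * n * (n + 1) / 2)) ∧
    ((∀ n : ℕ, tenthChiTerm q⁻¹ n = (-1) ^ n * q ^ (n * (n + 1)) / qPoch (-q) q (2 * n + 1)) ∧
      Summable (fun n : ℕ => (-1) ^ n * q ^ (n * (n + 1)) / qPoch (-q) q (2 * n + 1)) ∧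
      Summable (fun n : ℕ => q ^ (-n : ℤ) * q ^ (5 * n * (n + 1) / 2)) ∧
      Summable (fun n : ℕ => q ^ (n : ℤ) * q ^ (5 * n * (n + 1) / 2)) ∧
      ∑' n : ℕ, (-1) ^ n * q ^ (n * (n + 1)) / qPoch (-q) q (2 * n + 1) =
        (∑' n : ℕ, q ^ (-n : ℤ) * q ^ (5 * n * (n + 1) / 2)) -
          q * ∑' n : ℕ, q ^ (n : ℤ) * q ^ (5 * n * (n + 1) / 2)) := by
  -- A square root of `q` makes all exponents below integral.
  obtain ⟨p, hpq⟩ := IsAlgClosed.exists_pow_nat_eq q two_pos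
  have hp0 : p ≠ 0 := fun h => hq0 (by rw [← hpq, h, zero_pow two_ne_zero])
  have hp1 : ‖p‖ < 1 := by
    rw [← hpq, norm_pow] at hq1
    exact lt_of_pow_lt_pow_left₀ 2 zero_le_one (by rwa [one_pow])
  have alt : ∀ (k : ℤ) (l : ℕ → ℤ), (∀ n : ℕ, 5 * n + l n = k * n) →
      (fun n : ℕ => (-1) ^ n * q ^ l n * q ^ (5 * n * (n + 1))) =
        fun n : ℕ => (-1) ^ n * q ^ (5 * (n : ℤ) ^ 2 + k * n) := fun k l h => by
    ext n
    rw [mul_assoc, zpow_mul_pow_five hq0, h]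
  have pos : ∀ (k : ℤ) (l : ℕ → ℤ), (∀ n : ℕ, 5 * n + 2 * l n = k * n) →
      (fun n : ℕ => q ^ l n * q ^ (5 * n * (n + 1) / 2)) =
        fun n : ℕ => p ^ (5 * (n : ℤ) ^ 2 + k * n) := fun k l h => by
    ext n
    rw [← hpq, sq_zpow_mul_pow_five_half hp0, h]
  rw [alt 4 (fun n => -n) (fun n => by ring), alt 6 (fun n => n) (fun n => by ring),
    alt 2 (fun n => -3 * n) (fun n => by ring), alt 8 (fun n => 3 * n) (fun n => by ring),
    pos 1 (fun n => -2 * n) (fun n => by ring), pos 9 (fun n => 2 * n) (fun n => by ring),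
    pos 3 (fun n => -n) (fun n => by ring), pos 7 (fun n => n) (fun n => by ring)]
  have hX := X_inv_hasSum hp0 hp1
  have hχ := chi_inv_hasSum hp0 hp1
  rw [hpq] at hX hχ
  have hφ := phi_inv_hasSum hq0 hq1
  have hψ := psi_inv_hasSum hq0 hq1
  have sa := summable_alternating_quintic_theta hq0 hq1
  have sp := summable_quintic_theta hp0 hp1
  exact ⟨⟨tenthPhiTerm_inv hq0 hq1, hφ.summable, sa 4, sa 6, hφ.tsum_eq⟩,
    ⟨tenthPsiTerm_inv hq0 hq1, hψ.summable, sa 2, sa 8, hψ.tsum_eq⟩,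
    ⟨tenthXTerm_inv hq0 hq1, hX.summable, sp 1, sp 9, hX.tsum_eq⟩,
    ⟨tenthChiTerm_inv hq0 hq1, hχ.summable, sp 3, sp 7, hχ.tsum_eq⟩⟩
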